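/- **Theorem (Generalized Commute Time Formula).** Let $G=(V,E,w)$ be a finite connected weighted undirected graph without loops or multiple edges, with symmetric weights $w_{ij}\ge 0$ such that $w_{ij}>0$ if and only if $\{i,j\}\in E$. Let $d_i=\sum_j w_{ij}$, $\operatorname{vol}(G)=\sum_{i} d_i$, let $L=D-A$ be the Laplacian matrix (with $D=\operatorname{diag}(d_i)$, $A=(w_{ij})$), and let $L^\dagger$ be its Moore–Penrose pseudoinverse. Let $\mathcal P(V)$ be the set of probability vectors on $V$ and, for $\alpha,\beta\in\mathcal P(V)$, put $$r_{\alpha\beta}=(\alpha-\beta)^T L^\dagger(\alpha-\beta).$$ Let $(X_t)_{t\ge 0}$ be the simple random walk on $G$, with transition probabilities $w_{ij}/d_i$. A stopping rule $\Gamma$ assigns to each finite path $(X_0,\dots,X_k)$ a probability in $[0,1]$ of continuing the walk after that path has been observed; $\mathbb E[\Gamma]\in[0,\infty]$ is the mean number of steps made and $X_\Gamma$ is the position at which the walk is stopped. The access time is $$H(\alpha,\beta)=\inf\{\mathbb E[\Gamma\mid X_0\sim\alpha] : \mathbb E[\Gamma]<\infty,\ X_\Gamma\sim\beta\}.$$ Write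 $H(\alpha,k)=H(\alpha,\delta_k)$, $H(i,k)=H(\delta_i,\delta_k)$ and $H_\alpha=(H(\alpha,i))_{i\in V}$. Then $H(\mu,i)$ is finite for all $\mu\in\mathcal P(V)$ and $i\in V$, and for all $\alpha,\beta\in\mathcal P(V)$ $$r_{\alpha\beta}=-\frac1{\operatorname{vol}(G)}(\alpha-\beta)^T(H_\alpha-H_\beta) =-\frac1{\operatorname{vol}(G)}\sum_{i\in V}(\alpha_i-\beta_i)\bigl(H(\alpha,i)-H(\beta,i)\bigr) =-\frac1{\operatorname{vol}(G)}\sum_{i,k\in V}(\alpha_i-\beta_i)(\alpha_k-\beta_k)H(i,k).$$ In particular, for nodes $i,j$, the access time $H(i,j)$ is the mean hitting time $\mathbb E[T_j\mid X_0=i]$ with $T_j=\inf\{t\ge 0: X_t=j\}$, and $$r_{\delta_i\delta_j}=\frac1{\operatorname{vol}(G)}\bigl(H(i,j)+H(j,i)\bigr),$$ which is the classical commute time identity. (If $|V|=1$, then $\operatorname{vol}(G)=0$; $1/\operatorname{vol}(G)$ is then read as $0$ and the identities say $0=0$.) -/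

import Mathlib

/-- A weighted undirected graph without loops or multiple edges: the weights are symmetric and
nonnegative, and `w i j > 0` exactly when `{i, j}` is an edge. -/
structure WeightedGraph (V : Type*) where
  graph : SimpleGraph V
  w : V → V → ℝ
  w_symm : ∀ i j, w i j = w j i
  w_nonneg : ∀ i j, 0 ≤ w i j
  w_pos_iff : ∀ i j, 0 < w i j ↔ graph.Adj i j

/-- The four Penrose conditions: `Y` is the Moore-Penrose pseudoinverse of `X`. -/
structure IsMoorePenrose {m n : Type*} [Fintype m] [Fintype n]
    (X : Matrix m n ℝ) (Y : Matrix n m ℝ) : Prop where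
  mul_mul_left : X * Y * X = X
  mul_mul_right : Y * X * Y = Y
  symm_left : (X * Y).transpose = X * Y
  symm_right : (Y * X).transpose = Y * X

theorem IsMoorePenrose.unique {m n : Type*} [Fintype m] [Fintype n]
    {X : Matrix m n ℝ} {Y Z : Matrix n m ℝ}
    (hY : IsMoorePenrose X Y) (hZ : IsMoorePenrose X Z) : Y = Z := by
  have h1 : X * Y = X * Z := by
    calc X * Y = (X * Y).transpose := hY.symm_left.symm
      _ = ((X * Z) * (X * Y)).transpose := by
          rw [← Matrix.mul_assoc, hZ.mul_mul_left]
      _ = (X * Y) * (X * Z) := by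
          rw [Matrix.transpose_mul, hY.symm_left, hZ.symm_left]
      _ = X * Z := by rw [← Matrix.mul_assoc, hY.mul_mul_left]
  have h2 : Y * X = Z * X := by
    calc Y * X = (Y * X).transpose := hY.symm_right.symm
      _ = ((Y * X) * (Z * X)).transpose := by
          rw [Matrix.mul_assoc, ← Matrix.mul_assoc X, hZ.mul_mul_left]
      _ = (Z * X) * (Y * X) := by
          rw [Matrix.transpose_mul, hY.symm_right, hZ.symm_right]
      _ = Z * X := by rw [Matrix.mul_assoc, ← Matrix.mul_assoc X, hY.mul_mul_left]
  calc Y = Y * X * Y := hY.mul_mul_right.symm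
    _ = Z * X * Y := by rw [h2]
    _ = Z * X * Z := by rw [Matrix.mul_assoc, h1, ← Matrix.mul_assoc]
    _ = Z := hZ.mul_mul_right

theorem exists_isMoorePenrose {n : Type*} [Fintype n] [DecidableEq n]
    {X : Matrix n n ℝ} (hX : X.IsHermitian) : ∃ Y, IsMoorePenrose X Y := by
  obtain ⟨U, hU, d, hd⟩ : ∃ U : Matrix n n ℝ, U.transpose * U = 1 ∧
      ∃ d : n → ℝ, X = U * Matrix.diagonal d * U.transpose := by
    refine ⟨hX.eigenvectorUnitary, ?_, hX.eigenvalues, ?_⟩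
    · have := (Matrix.mem_unitaryGroup_iff').1 hX.eigenvectorUnitary.2
      simpa [Matrix.star_eq_conjTranspose, Matrix.conjTranspose_eq_transpose_of_trivial] using this
    · have := hX.spectral_theorem
      simpa [Unitary.conjStarAlgAut_apply, Matrix.star_eq_conjTranspose,
        Matrix.conjTranspose_eq_transpose_of_trivial, Function.comp_def] using this
  have key : ∀ a b : n → ℝ,
      (U * Matrix.diagonal a * U.transpose) * (U * Matrix.diagonal b * U.transpose) =
        U * Matrix.diagonal (fun i => a i * b i) * U.transpose := by
    intro a b
    calc _ = U * Matrix.diagonal a * (U.transpose * U) * Matrix.diagonal b * U.transpose := by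
          simp only [Matrix.mul_assoc]
      _ = _ := by rw [hU, Matrix.mul_one, Matrix.mul_assoc U, Matrix.diagonal_mul_diagonal]
  have tr : ∀ a : n → ℝ, (U * Matrix.diagonal a * U.transpose).transpose =
      U * Matrix.diagonal a * U.transpose := by
    intro a
    simp [Matrix.transpose_mul, Matrix.mul_assoc]
  refine ⟨U * Matrix.diagonal (fun i => (d i)⁻¹) * U.transpose, ?_, ?_, ?_, ?_⟩
  · rw [hd, key, key]; simp
  · rw [hd, key, key]
    congr 3; ext i
    by_cases h : d i = 0 <;> simp [h]
  · rw [hd, key, tr]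
  · rw [hd, key, tr]

/-- The Moore-Penrose pseudoinverse of a real symmetric matrix. -/
noncomputable def pseudoinverse {n : Type*} [Fintype n] [DecidableEq n]
    (X : Matrix n n ℝ) (hX : X.IsHermitian) : Matrix n n ℝ :=
  Classical.choose (exists_isMoorePenrose hX)

theorem pseudoinverse_spec {n : Type*} [Fintype n] [DecidableEq n]
    (X : Matrix n n ℝ) (hX : X.IsHermitian) : IsMoorePenrose X (pseudoinverse X hX) :=
  Classical.choose_spec (exists_isMoorePenrose hX)

/-- A stopping rule: to each finite path `(ω 0, …, ω k)` it assigns the probability in `[0, 1]`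
of continuing the walk, given that this is the walk observed so far.  (Its values on sequences
that are not paths of the graph play no role: the walk follows them with probability zero.) -/
structure StoppingRule (V : Type*) where
  continueProb : (k : ℕ) → (Fin (k + 1) → V) → ℝ
  continueProb_nonneg : ∀ k ω, 0 ≤ continueProb k ω
  continueProb_le_one : ∀ k ω, continueProb k ω ≤ 1

namespace WeightedGraph

variable {V : Type*} [Fintype V]

/-- The weighted degree `d_i`. -/
noncomputable def degree (G : WeightedGraph V) (i : V) : ℝ := ∑ j, G.w i j

/-- The volume of the graph. -/
noncomputable def vol (G : WeightedGraph V) : ℝ := ∑ i, G.degree i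

/-- The Laplacian matrix `L = D - A`. -/
noncomputable def laplacian [DecidableEq V] (G : WeightedGraph V) : Matrix V V ℝ :=
  Matrix.diagonal G.degree - Matrix.of G.w

theorem laplacian_isHermitian [DecidableEq V] (G : WeightedGraph V) :
    G.laplacian.IsHermitian := by
  refine Matrix.IsHermitian.sub (Matrix.isHermitian_diagonal _) ?_
  ext i j
  simp [Matrix.conjTranspose_apply, G.w_symm j i]

/-- The measure effective resistance `r_{αβ} = (α - β)ᵀ L† (α - β)`. -/
noncomputable def resistance [DecidableEq V] (G : WeightedGraph V) (α β : V → ℝ) : ℝ :=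
  dotProduct (α - β)
    (Matrix.mulVec (pseudoinverse G.laplacian G.laplacian_isHermitian) (α - β))

/-- The transition matrix `D⁻¹ A` of the simple random walk. -/
noncomputable def transition (G : WeightedGraph V) (i j : V) : ℝ := G.w i j / G.degree i

/-- `P[X₀ = ω 0, …, X_k = ω k]` for the simple random walk with `X₀ ∼ α`. -/
noncomputable def pathProb (G : WeightedGraph V) (α : V → ℝ) (k : ℕ) (ω : Fin (k + 1) → V) : ℝ :=
  α (ω 0) * ∏ t : Fin k, G.transition (ω t.castSucc) (ω t.succ)

/-- The probability that the walk with `X₀ ∼ α` follows `ω 0, …, ω k` and that the rule `Γ`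
lets it continue at each of the times `0, …, k - 1` and stops it at time `k`. -/
noncomputable def pathStopProb (G : WeightedGraph V) (α : V → ℝ) (Γ : StoppingRule V) (k : ℕ)
    (ω : Fin (k + 1) → V) : ℝ :=
  G.pathProb α k ω *
    (∏ t : Fin k,
      Γ.continueProb t (fun s : Fin (t + 1) => ω (s.castLE (Nat.succ_le_succ t.is_lt.le)))) *
    (1 - Γ.continueProb k ω)

/-- The joint law `P[Γ = k, X_Γ = i]` of the stopping time and the stopping position. -/
noncomputable def stopProb [DecidableEq V] (G : WeightedGraph V) (α : V → ℝ) (Γ : StoppingRule V)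
    (k : ℕ) (i : V) : ℝ :=
  ∑ ω : Fin (k + 1) → V with ω (Fin.last k) = i, G.pathStopProb α Γ k ω

/-- `P[Γ = k]`. -/
noncomputable def lengthProb [DecidableEq V] (G : WeightedGraph V) (α : V → ℝ)
    (Γ : StoppingRule V) (k : ℕ) : ENNReal :=
  ENNReal.ofReal (∑ i, G.stopProb α Γ k i)

/-- `P[X_Γ = i]`. -/
noncomputable def positionProb [DecidableEq V] (G : WeightedGraph V) (α : V → ℝ)
    (Γ : StoppingRule V) (i : V) : ENNReal :=
  ∑' k, ENNReal.ofReal (G.stopProb α Γ k i)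

/-- The mean length `E[Γ | X₀ ∼ α] = ∑ k · P[Γ = k] + ∞ · P[Γ = ∞]`, in `[0, ∞]`. -/
noncomputable def meanLength [DecidableEq V] (G : WeightedGraph V) (α : V → ℝ)
    (Γ : StoppingRule V) : ENNReal :=
  ∑' k : ℕ, (k : ENNReal) * G.lengthProb α Γ k + ⊤ * (1 - ∑' k : ℕ, G.lengthProb α Γ k)

/-- The access time `H(α, β)`: the least mean length of a stopping rule of finite mean length
that leads from `α` to `β`.  It is `∞` if there is no such rule. -/
noncomputable def accessTime [DecidableEq V] (G : WeightedGraph V) (α β : V → ℝ) : ENNReal :=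
  sInf {t | ∃ Γ : StoppingRule V, G.meanLength α Γ = t ∧ t < ⊤ ∧
    ∀ i, G.positionProb α Γ i = ENNReal.ofReal (β i)}

/-- The function `H_α(i) = H(α, δ_i)` on the nodes. -/
noncomputable def accessVec [DecidableEq V] (G : WeightedGraph V) (α : V → ℝ) (i : V) : ℝ :=
  (G.accessTime α (Pi.single i 1)).toReal

/-- `H(i, k) = H(δ_i, δ_k)` for nodes `i`, `k`. -/
noncomputable def nodeAccess [DecidableEq V] (G : WeightedGraph V) (i k : V) : ℝ :=
  (G.accessTime (Pi.single i 1) (Pi.single k 1)).toReal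

end WeightedGraph

/-- The stopping rule that stops at the first visit to `j`, that is at
`T_j = inf {t ≥ 0 : X_t = j}`. -/
noncomputable def hittingRule {V : Type*} [DecidableEq V] (j : V) : StoppingRule V where
  continueProb k ω := if ω (Fin.last k) = j then 0 else 1
  continueProb_nonneg k ω := by split_ifs <;> norm_num
  continueProb_le_one k ω := by split_ifs <;> norm_num

/-- The mean hitting time `E[T_j | X₀ = i]`. -/
noncomputable def WeightedGraph.hittingTime {V : Type*} [Fintype V] [DecidableEq V]
    (G : WeightedGraph V) (i j : V) : ENNReal :=
  G.meanLength (Pi.single i 1) (hittingRule j)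

/-! Write `M` for the pseudoinverse of the Laplacian `L`, `d` for the degree vector, `P` for the
transition matrix and `e_j` for the Dirac vector at `j`. Since `d - vol • e_j` has sum zero, it lies
in the range of `L`, so `M (d - vol • e_j)`, shifted by a constant to vanish at `j`, gives `h_j`
with `L h_j = d - vol • e_j`. For positive degrees this says `P h_j = h_j - 1` off `j` and `P h_j ≥
h_j - 1` at `j`: the process `h_j (X_k) + k` is a submartingale, and a martingale up to the first
visit to `j`.

Optional stopping then identifies the access times. A rule of finite mean length ending at `j` has
mean length at least `∑ μ_i h_j(i)` (`sum_hittingPotential_le_meanLength`), and the hitting rule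
attains this bound (`meanLength_hittingRule_le`). Hence `H(μ, j) = ∑ μ_i h_j(i)`, which is linear in
`μ`.

Finally `h_k(i) = (M d)_i - vol * M_ik - c_k`. Against `x_i x_k` with `∑ x_i = 0`, the terms
depending on only one index drop out, leaving `-vol * xᵀ M x` (`sum_sum_hittingPotential`); take `x
= α - β`. -/

namespace WeightedGraph

/-! ### The walk under a stopping rule -/

section Walk

variable {V : Type*} [Fintype V] (G : WeightedGraph V)

theorem degree_nonneg (i : V) : 0 ≤ G.degree i :=
  Finset.sum_nonneg fun _ _ => G.w_nonneg _ _

theorem transition_nonneg (i j : V) : 0 ≤ G.transition i j :=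
  div_nonneg (G.w_nonneg _ _) (G.degree_nonneg _)

theorem sum_transition {i : V} (hi : 0 < G.degree i) : ∑ j, G.transition i j = 1 := by
  simp only [transition, ← Finset.sum_div]
  exact div_self hi.ne'

/-- The probability that the walk with `X₀ ∼ α` follows `ω 0, …, ω k` and that the rule `Γ`
lets it continue at each of the times `0, …, k - 1`. -/
noncomputable def aliveProb (α : V → ℝ) (Γ : StoppingRule V) (k : ℕ) (ω : Fin (k + 1) → V) : ℝ :=
  G.pathProb α k ω *
    ∏ t : Fin k,
      Γ.continueProb t (fun s : Fin (t + 1) => ω (s.castLE (Nat.succ_le_succ t.is_lt.le)))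

theorem aliveProb_nonneg {α : V → ℝ} (hα : ∀ i, 0 ≤ α i) (Γ : StoppingRule V) (k : ℕ)
    (ω : Fin (k + 1) → V) : 0 ≤ G.aliveProb α Γ k ω :=
  mul_nonneg (mul_nonneg (hα _) (Finset.prod_nonneg fun _ _ => G.transition_nonneg _ _))
    (Finset.prod_nonneg fun _ _ => Γ.continueProb_nonneg _ _)

theorem pathStopProb_eq (α : V → ℝ) (Γ : StoppingRule V) (k : ℕ) (ω : Fin (k + 1) → V) :
    G.pathStopProb α Γ k ω = G.aliveProb α Γ k ω * (1 - Γ.continueProb k ω) := rfl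

/-- The Markov property in path form; every recursion in `k` below rests on it. Only the last factor
of each product is new, since the earlier factors see only `ω`. -/
theorem aliveProb_snoc (α : V → ℝ) (Γ : StoppingRule V) (k : ℕ) (ω : Fin (k + 1) → V) (l : V) :
    G.aliveProb α Γ (k + 1) (Fin.snoc (α := fun _ => V) ω l) =
      G.aliveProb α Γ k ω * Γ.continueProb k ω * G.transition (ω (Fin.last k)) l := by
  have hsnoc : ∀ (t : ℕ) (ht : t + 1 ≤ k + 1),
      (fun s : Fin (t + 1) => Fin.snoc (α := fun _ => V) ω l
        (s.castLE (ht.trans (Nat.le_succ _)) : Fin (k + 2))) = fun s => ω (s.castLE ht) := by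
    intro t ht
    funext s
    exact Fin.snoc_castSucc (α := fun _ => V) l ω (s.castLE ht)
  have h0 : Fin.snoc (α := fun _ => V) ω l 0 = ω 0 :=
    Fin.snoc_castSucc (α := fun _ => V) l ω 0
  unfold aliveProb pathProb
  rw [Fin.prod_univ_castSucc, Fin.prod_univ_castSucc, h0]
  have h1 : ∀ t : Fin k, Fin.snoc (α := fun _ => V) ω l t.castSucc.succ = ω t.succ := fun t =>
    Fin.snoc_castSucc (α := fun _ => V) l ω t.succ
  have h2 : Γ.continueProb k (fun s : Fin (k + 1) => Fin.snoc (α := fun _ => V) ω l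
      (s.castLE (Nat.le_succ _) : Fin (k + 2))) = Γ.continueProb k ω := by
    rw [hsnoc k le_rfl]; rfl
  have h3 : ∀ t : Fin k, Γ.continueProb t (fun s : Fin (t + 1) => Fin.snoc (α := fun _ => V) ω l
      (s.castLE (Nat.succ_le_succ (t.is_lt.le.trans (Nat.le_succ _))) : Fin (k + 2))) =
      Γ.continueProb t (fun s : Fin (t + 1) => ω (s.castLE (Nat.succ_le_succ t.is_lt.le))) :=
    fun t => by rw [hsnoc t (Nat.succ_le_succ t.is_lt.le)]
  simp only [Fin.snoc_castSucc, h1, Fin.succ_last, Fin.snoc_last, Fin.val_castSucc, Fin.val_last]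
  rw [Finset.prod_congr rfl fun t _ => h3 t]
  refine Eq.trans (congrArg₂ (· * ·) rfl (congrArg₂ (· * ·) rfl h2)) ?_
  ring

/-- The mean of `f (X_k)` over the walks that are not stopped before time `k`. -/
noncomputable def aliveMean (α : V → ℝ) (Γ : StoppingRule V) (k : ℕ) (f : V → ℝ) : ℝ :=
  ∑ ω : Fin (k + 1) → V, G.aliveProb α Γ k ω * f (ω (Fin.last k))

theorem aliveMean_zero (α : V → ℝ) (Γ : StoppingRule V) (f : V → ℝ) :
    G.aliveMean α Γ 0 f = ∑ i, α i * f i := by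
  unfold aliveMean
  rw [← (Equiv.funUnique (Fin 1) V).symm.sum_comp]
  simp [aliveProb, pathProb]

theorem aliveMean_succ (α : V → ℝ) (Γ : StoppingRule V) (k : ℕ) (f : V → ℝ) :
    G.aliveMean α Γ (k + 1) f = ∑ ω : Fin (k + 1) → V, G.aliveProb α Γ k ω *
      Γ.continueProb k ω * ∑ l, G.transition (ω (Fin.last k)) l * f l := by
  unfold aliveMean
  rw [← (Fin.snocEquiv fun _ : Fin (k + 2) => V).sum_comp, Fintype.sum_prod_type,
    Finset.sum_comm]
  refine Finset.sum_congr rfl fun ω _ => ?_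
  rw [Finset.mul_sum]
  refine Finset.sum_congr rfl fun l _ => ?_
  have h : G.aliveProb α Γ (k + 1) (Fin.snocEquiv (fun _ => V) (l, ω)) = _ :=
    G.aliveProb_snoc α Γ k ω l
  rw [h, Fin.snocEquiv_apply, Fin.snoc_last, mul_assoc]

theorem aliveMean_one_nonneg {α : V → ℝ} (hα : ∀ i, 0 ≤ α i) (Γ : StoppingRule V) (k : ℕ) :
    0 ≤ G.aliveMean α Γ k 1 :=
  Finset.sum_nonneg fun _ _ => mul_nonneg (G.aliveProb_nonneg hα _ _ _) zero_le_one

theorem abs_aliveMean_le {α : V → ℝ} (hα : ∀ i, 0 ≤ α i) (Γ : StoppingRule V) (k : ℕ)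
    {f : V → ℝ} {B : ℝ} (hB : ∀ i, |f i| ≤ B) :
    |G.aliveMean α Γ k f| ≤ B * G.aliveMean α Γ k 1 := by
  unfold aliveMean
  rw [Finset.mul_sum]
  refine (Finset.abs_sum_le_sum_abs _ _).trans (Finset.sum_le_sum fun ω _ => ?_)
  have h0 := G.aliveProb_nonneg hα Γ k ω
  rw [abs_mul, abs_of_nonneg h0, Pi.one_apply, mul_one, mul_comm]
  exact mul_le_mul_of_nonneg_right (hB _) h0

variable [DecidableEq V]

theorem stopProb_nonneg {α : V → ℝ} (hα : ∀ i, 0 ≤ α i) (Γ : StoppingRule V) (k : ℕ) (i : V) :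
    0 ≤ G.stopProb α Γ k i :=
  Finset.sum_nonneg fun ω _ => by
    rw [pathStopProb_eq]
    exact mul_nonneg (G.aliveProb_nonneg hα _ _ _)
      (sub_nonneg.2 (Γ.continueProb_le_one _ _))

theorem sum_stopProb_mul (α : V → ℝ) (Γ : StoppingRule V) (k : ℕ) (f : V → ℝ) :
    ∑ i, G.stopProb α Γ k i * f i = ∑ ω : Fin (k + 1) → V,
      G.aliveProb α Γ k ω * (1 - Γ.continueProb k ω) * f (ω (Fin.last k)) := by
  rw [← Finset.sum_fiberwise (s := Finset.univ) (g := fun ω : Fin (k + 1) → V => ω (Fin.last k))]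
  refine Finset.sum_congr rfl fun i _ => ?_
  rw [stopProb, Finset.sum_mul]
  refine Finset.sum_congr rfl fun ω hω => ?_
  rw [(Finset.mem_filter.1 hω).2, pathStopProb_eq]

theorem aliveMean_sub_sum_stopProb (α : V → ℝ) (Γ : StoppingRule V) (k : ℕ) (f : V → ℝ) :
    G.aliveMean α Γ k f - ∑ i, G.stopProb α Γ k i * f i = ∑ ω : Fin (k + 1) → V,
      G.aliveProb α Γ k ω * Γ.continueProb k ω * f (ω (Fin.last k)) := by
  rw [sum_stopProb_mul, aliveMean, ← Finset.sum_sub_distrib]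
  exact Finset.sum_congr rfl fun ω _ => by ring

/-- If the walk can only be continued at nodes of positive degree, no mass is lost. -/
theorem aliveMean_succ_one (α : V → ℝ) (Γ : StoppingRule V) (k : ℕ)
    (h : ∀ ω, Γ.continueProb k ω ≠ 0 → 0 < G.degree (ω (Fin.last k))) :
    G.aliveMean α Γ (k + 1) 1 = G.aliveMean α Γ k 1 - ∑ i, G.stopProb α Γ k i := by
  have := G.aliveMean_sub_sum_stopProb α Γ k 1
  simp only [Pi.one_apply, mul_one] at this
  rw [this, aliveMean_succ]
  refine Finset.sum_congr rfl fun ω _ => ?_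
  by_cases hω : Γ.continueProb k ω = 0
  · simp [hω]
  · simp [G.sum_transition (h ω hω)]

theorem sum_range_stopProb {α : V → ℝ} (hα : α ∈ stdSimplex ℝ V) (Γ : StoppingRule V)
    (h : ∀ k ω, Γ.continueProb k ω ≠ 0 → 0 < G.degree (ω (Fin.last k))) (n : ℕ) :
    ∑ k ∈ Finset.range n, ∑ i, G.stopProb α Γ k i = 1 - G.aliveMean α Γ n 1 := by
  induction n with
  | zero => simp [aliveMean_zero, hα.2]
  | succ n ih => rw [Finset.sum_range_succ, ih, G.aliveMean_succ_one α Γ n (h n)]; ring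

/-- Summation by parts: when `α` is a probability vector, `aliveMean` of `1` at time `k` is `P[Γ ≥
k]`, and both sides are the mean of `min(Γ, n)`. -/
theorem sum_range_aliveMean (α : V → ℝ) (Γ : StoppingRule V)
    (h : ∀ k ω, Γ.continueProb k ω ≠ 0 → 0 < G.degree (ω (Fin.last k))) (n : ℕ) :
    ∑ k ∈ Finset.range n, G.aliveMean α Γ (k + 1) 1 =
      ∑ k ∈ Finset.range n, k * ∑ i, G.stopProb α Γ k i + n * G.aliveMean α Γ n 1 := by
  induction n with
  | zero => simp
  | succ n ih =>
    rw [Finset.sum_range_succ, ih, Finset.sum_range_succ, G.aliveMean_succ_one α Γ n (h n)]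
    push_cast
    ring

end Walk

/-! ### The Laplacian and the hitting potentials -/

section Potential

variable {V : Type*} [Fintype V] (G : WeightedGraph V)

theorem degree_pos [Nontrivial V] (hG : G.graph.Connected) (i : V) : 0 < G.degree i := by
  obtain ⟨j, hj⟩ := hG.preconnected.exists_adj_of_nontrivial i
  exact ((G.w_pos_iff i j).2 hj).trans_le
    (Finset.single_le_sum (f := G.w i) (fun _ _ => G.w_nonneg _ _) (Finset.mem_univ j))

theorem vol_pos (hG : G.graph.Connected) [Nontrivial V] : 0 < G.vol :=
  have := hG.nonempty
  Finset.sum_pos (fun i _ => G.degree_pos hG i) Finset.univ_nonempty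

variable [DecidableEq V]

theorem laplacian_mulVec (f : V → ℝ) (i : V) :
    G.laplacian.mulVec f i = G.degree i * f i - ∑ j, G.w i j * f j := by
  rw [laplacian, Matrix.sub_mulVec, Pi.sub_apply, Matrix.mulVec_diagonal]
  rfl

/-- The Dirichlet energy. The factor `2` comes from averaging the form with its copy under the
exchange of `i` and `j`. -/
theorem dotProduct_laplacian_mulVec (f : V → ℝ) :
    2 * dotProduct f (G.laplacian.mulVec f) = ∑ i, ∑ j, G.w i j * (f i - f j) ^ 2 := by
  have h1 : dotProduct f (G.laplacian.mulVec f) = ∑ i, ∑ j, G.w i j * (f i * f i - f i * f j) := by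
    refine Finset.sum_congr rfl fun i _ => ?_
    rw [laplacian_mulVec, degree, Finset.sum_mul, ← Finset.sum_sub_distrib, Finset.mul_sum]
    exact Finset.sum_congr rfl fun j _ => by ring
  have h2 : dotProduct f (G.laplacian.mulVec f) = ∑ i, ∑ j, G.w i j * (f j * f j - f i * f j) := by
    rw [h1, Finset.sum_comm]
    refine Finset.sum_congr rfl fun i _ => Finset.sum_congr rfl fun j _ => ?_
    rw [G.w_symm j i]; ring
  rw [two_mul]
  nth_rw 1 [h1]
  rw [h2, ← Finset.sum_add_distrib]
  refine Finset.sum_congr rfl fun i _ => ?_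
  rw [← Finset.sum_add_distrib]
  exact Finset.sum_congr rfl fun j _ => by ring

/-- On a connected graph the kernel of the Laplacian consists of the constants. -/
theorem eq_of_laplacian_mulVec_eq_zero (hG : G.graph.Connected) {f : V → ℝ}
    (hf : G.laplacian.mulVec f = 0) (i j : V) : f i = f j := by
  have h := G.dotProduct_laplacian_mulVec f
  rw [hf, dotProduct_zero, mul_zero] at h
  have hnn : ∀ i j, 0 ≤ G.w i j * (f i - f j) ^ 2 := fun i j =>
    mul_nonneg (G.w_nonneg _ _) (sq_nonneg _)
  have hadj : ∀ i j, G.graph.Adj i j → f i = f j := by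
    intro i j hij
    have h1 := (Finset.sum_eq_zero_iff_of_nonneg fun i _ =>
      Finset.sum_nonneg fun j _ => hnn i j).1 h.symm i (Finset.mem_univ _)
    have h2 := (Finset.sum_eq_zero_iff_of_nonneg fun j _ => hnn i j).1 h1 j (Finset.mem_univ _)
    have h3 := (mul_eq_zero.1 h2).resolve_left ((G.w_pos_iff i j).2 hij).ne'
    exact sub_eq_zero.1 (pow_eq_zero_iff two_ne_zero |>.1 h3)
  obtain ⟨p⟩ := hG.preconnected i j
  induction p with
  | nil => rfl
  | cons hij _ ih => exact (hadj _ _ hij).trans ih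

/-- The matrix `1 - L * M` is symmetric and `L` annihilates its columns, so these are constant. By
symmetry its rows are constant too, and constant rows annihilate vectors of sum zero. -/
theorem laplacian_mulVec_pseudoinverse (hG : G.graph.Connected) {v : V → ℝ} (hv : ∑ i, v i = 0) :
    G.laplacian.mulVec ((pseudoinverse G.laplacian G.laplacian_isHermitian).mulVec v) = v := by
  set L := G.laplacian with hL
  set M := pseudoinverse L G.laplacian_isHermitian with hM
  have hMP : IsMoorePenrose L M := pseudoinverse_spec L _
  have hLt : L.transpose = L := by
    have := G.laplacian_isHermitian
    rwa [Matrix.IsHermitian, Matrix.conjTranspose_eq_transpose_of_trivial] at this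
  have hQt : (1 - L * M).transpose = 1 - L * M := by
    rw [Matrix.transpose_sub, Matrix.transpose_one, hMP.symm_left]
  have hLQ : L * (1 - L * M) = 0 := by
    have : ((1 - L * M) * L).transpose = 0 := by
      rw [sub_mul, one_mul, hMP.mul_mul_left, sub_self, Matrix.transpose_zero]
    rwa [Matrix.transpose_mul, hLt, hQt] at this
  have hcol : ∀ i i' k, (1 - L * M) i k = (1 - L * M) i' k := by
    intro i i' k
    refine G.eq_of_laplacian_mulVec_eq_zero hG (f := fun i => (1 - L * M) i k) ?_ i i'
    funext a
    exact congrFun (congrFun hLQ a) k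
  have hrow : ∀ i k k', (1 - L * M) i k = (1 - L * M) i k' := by
    intro i k k'
    rw [← hQt, Matrix.transpose_apply, Matrix.transpose_apply]
    exact hcol k k' i
  have hQv : (1 - L * M).mulVec v = 0 := by
    funext i
    have : (1 - L * M).mulVec v i = ∑ k, (1 - L * M) i i * v k :=
      Finset.sum_congr rfl fun k _ => congrArg (· * v k) (hrow i k i)
    rw [this, ← Finset.mul_sum, hv, mul_zero, Pi.zero_apply]
  rw [Matrix.mulVec_mulVec]
  rw [Matrix.sub_mulVec, Matrix.one_mulVec, sub_eq_zero] at hQv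
  exact hQv.symm

/-- The function of the nodes that turns out to be the mean hitting time of `j`. -/
noncomputable def hittingPotential (j i : V) : ℝ :=
  (pseudoinverse G.laplacian G.laplacian_isHermitian).mulVec
      (G.degree - G.vol • Pi.single j 1) i -
    (pseudoinverse G.laplacian G.laplacian_isHermitian).mulVec
      (G.degree - G.vol • Pi.single j 1) j

theorem hittingPotential_self (j : V) : G.hittingPotential j j = 0 := sub_self _

/-- The normalizing constant in the potential does not matter here, because the Laplacian kills
constants. -/
theorem degree_mul_hittingPotential (hG : G.graph.Connected) (j i : V) :
    G.degree i * G.hittingPotential j i - ∑ l, G.w i l * G.hittingPotential j l =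
      G.degree i - G.vol * (Pi.single j 1 : V → ℝ) i := by
  have h := congrFun (G.laplacian_mulVec_pseudoinverse hG
    (v := G.degree - G.vol • Pi.single j 1) (by simp [← Finset.mul_sum, vol])) i
  rw [laplacian_mulVec] at h
  simp only [hittingPotential, mul_sub, Finset.sum_sub_distrib, ← Finset.sum_mul]
  rw [show ∑ l, G.w i l = G.degree i from rfl]
  simp only [Pi.sub_apply, Pi.smul_apply, smul_eq_mul] at h ⊢
  linarith

theorem sum_transition_mul_hittingPotential (hG : G.graph.Connected) {j i : V}
    (hi : 0 < G.degree i) (hij : i ≠ j) :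
    ∑ l, G.transition i l * G.hittingPotential j l = G.hittingPotential j i - 1 := by
  have h := G.degree_mul_hittingPotential hG j i
  rw [Pi.single_eq_of_ne hij, mul_zero, sub_zero] at h
  simp only [transition, div_mul_eq_mul_div, ← Finset.sum_div]
  rw [div_eq_iff hi.ne']
  linarith

/-- At `i = j` the right side exceeds the left by `vol / d_j`; elsewhere equality holds. Rules may
pass through `j` without stopping, so the bound is needed there as well. -/
theorem le_sum_transition_mul_hittingPotential (hG : G.graph.Connected) {j i : V}
    (hi : 0 < G.degree i) :
    G.hittingPotential j i - 1 ≤ ∑ l, G.transition i l * G.hittingPotential j l := by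
  have h := G.degree_mul_hittingPotential hG j i
  have hvol : 0 ≤ G.vol * (Pi.single j 1 : V → ℝ) i :=
    mul_nonneg (Finset.sum_nonneg fun _ _ => Finset.sum_nonneg fun _ _ => G.w_nonneg _ _)
      (by by_cases hij : i = j <;> simp [hij])
  simp only [transition, div_mul_eq_mul_div, ← Finset.sum_div]
  rw [le_div_iff₀ hi]
  linarith

/-- The quadratic form of the hitting potentials on vectors of sum zero. -/
theorem sum_sum_hittingPotential {x : V → ℝ} (hx : ∑ i, x i = 0) :
    ∑ i, ∑ k, x i * x k * G.hittingPotential k i = -(G.vol * dotProduct x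
      ((pseudoinverse G.laplacian G.laplacian_isHermitian).mulVec x)) := by
  set M := pseudoinverse G.laplacian G.laplacian_isHermitian
  -- Only the middle term depends on both `i` and `k`; the other two vanish against `x i * x k`.
  have hentry : ∀ i k, G.hittingPotential k i =
      M.mulVec G.degree i - G.vol * M i k - M.mulVec (G.degree - G.vol • Pi.single k 1) k := by
    intro i k
    rw [hittingPotential]
    congr 1
    rw [Matrix.mulVec_sub, Matrix.mulVec_smul, Matrix.mulVec_single_one]
    rfl
  have h1 : ∑ i, ∑ k, x i * x k * M.mulVec G.degree i = 0 := by
    refine Finset.sum_eq_zero fun i _ => ?_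
    rw [← Finset.sum_mul, ← Finset.mul_sum, hx, mul_zero, zero_mul]
  have h2 : ∑ i, ∑ k, x i * x k * M.mulVec (G.degree - G.vol • Pi.single k 1) k = 0 := by
    rw [Finset.sum_comm]
    refine Finset.sum_eq_zero fun k _ => ?_
    rw [← Finset.sum_mul, ← Finset.sum_mul, hx, zero_mul, zero_mul]
  have h3 : ∑ i, ∑ k, x i * x k * (G.vol * M i k) = G.vol * dotProduct x (M.mulVec x) := by
    simp only [dotProduct, Matrix.mulVec, Finset.mul_sum]
    exact Finset.sum_congr rfl fun i _ => Finset.sum_congr rfl fun k _ => by ring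
  simp only [hentry, mul_sub, Finset.sum_sub_distrib]
  rw [h1, h2, h3]; ring

end Potential

/-! ### Optional stopping and access times -/

section Access

open Filter Topology

variable {V : Type*} [Fintype V] [DecidableEq V] (G : WeightedGraph V)

theorem sum_stopProb_nonneg {α : V → ℝ} (hα : ∀ i, 0 ≤ α i) (Γ : StoppingRule V) (k : ℕ) :
    0 ≤ ∑ i, G.stopProb α Γ k i :=
  Finset.sum_nonneg fun _ _ => G.stopProb_nonneg hα _ _ _

/-- Any deficit would be multiplied by `⊤`; a zero deficit contributes `⊤ * 0 = 0`. -/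
theorem tsum_lengthProb_of_meanLength_lt_top {α : V → ℝ} {Γ : StoppingRule V}
    (hfin : G.meanLength α Γ < ⊤) : 1 ≤ ∑' k, G.lengthProb α Γ k := by
  by_contra! h
  rw [meanLength, ENNReal.top_mul (tsub_pos_of_lt h).ne', add_top] at hfin
  exact lt_irrefl _ hfin

/-- The partial sums of `P[Γ ≥ m]`, `m ≥ 1`, are at most the mean length. -/
theorem ofReal_sum_range_aliveMean_le {α : V → ℝ} (hα : α ∈ stdSimplex ℝ V) {Γ : StoppingRule V}
    (h : ∀ k ω, Γ.continueProb k ω ≠ 0 → 0 < G.degree (ω (Fin.last k)))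
    (hfin : G.meanLength α Γ < ⊤) (n : ℕ) :
    ENNReal.ofReal (∑ k ∈ Finset.range n, G.aliveMean α Γ (k + 1) 1) ≤ G.meanLength α Γ := by
  have hs := G.sum_stopProb_nonneg hα.1 Γ
  have ha := G.aliveMean_one_nonneg hα.1 Γ
  -- The rule stops almost surely, so the mass still alive at time `n` is stopped at some time `k +
  -- n`, and there the weight `n` is at most `k + n`.
  have htail : ENNReal.ofReal (G.aliveMean α Γ n 1) ≤ ∑' k, G.lengthProb α Γ (k + n) := by
    have h1 := G.tsum_lengthProb_of_meanLength_lt_top hfin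
    have hp := G.sum_range_stopProb hα Γ h n
    have h2 : ∑ k ∈ Finset.range n, G.lengthProb α Γ k =
        ENNReal.ofReal (1 - G.aliveMean α Γ n 1) := by
      rw [← hp, ENNReal.ofReal_sum_of_nonneg fun k _ => hs k]
      rfl
    rw [← ENNReal.summable.sum_add_tsum_nat_add' (k := n), h2] at h1
    have h3 : (1 : ENNReal) = ENNReal.ofReal (1 - G.aliveMean α Γ n 1) +
        ENNReal.ofReal (G.aliveMean α Γ n 1) := by
      rw [← ENNReal.ofReal_add (hp ▸ Finset.sum_nonneg fun k _ => hs k) (ha n)]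
      simp
    rw [h3] at h1
    exact (ENNReal.add_le_add_iff_left ENNReal.ofReal_ne_top).1 h1
  rw [G.sum_range_aliveMean α Γ h n, ENNReal.ofReal_add
    (Finset.sum_nonneg fun k _ => mul_nonneg k.cast_nonneg (hs k))
    (mul_nonneg n.cast_nonneg (ha n)),
    ENNReal.ofReal_sum_of_nonneg fun k _ => mul_nonneg k.cast_nonneg (hs k)]
  calc _ = ∑ k ∈ Finset.range n, (k : ENNReal) * G.lengthProb α Γ k +
        n * ENNReal.ofReal (G.aliveMean α Γ n 1) := by
        rw [ENNReal.ofReal_mul n.cast_nonneg, ENNReal.ofReal_natCast]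
        congr 1
        refine Finset.sum_congr rfl fun k _ => ?_
        rw [ENNReal.ofReal_mul k.cast_nonneg, ENNReal.ofReal_natCast, lengthProb]
    _ ≤ ∑ k ∈ Finset.range n, (k : ENNReal) * G.lengthProb α Γ k +
        ∑' k : ℕ, ((k + n : ℕ) : ENNReal) * G.lengthProb α Γ (k + n) := by
        refine add_le_add le_rfl ((mul_le_mul_right htail _).trans ?_)
        rw [← ENNReal.tsum_mul_left]
        refine ENNReal.tsum_le_tsum fun k => mul_le_mul_left ?_ _
        exact_mod_cast Nat.le_add_left n k
    _ = ∑' k : ℕ, (k : ENNReal) * G.lengthProb α Γ k :=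
        ENNReal.summable.sum_add_tsum_nat_add'
          (f := fun k : ℕ => (k : ENNReal) * G.lengthProb α Γ k)
    _ ≤ G.meanLength α Γ := le_self_add

theorem aliveMean_hittingPotential_le (hG : G.graph.Connected) [Nontrivial V] {α : V → ℝ}
    (hα : ∀ i, 0 ≤ α i) (Γ : StoppingRule V) (j : V) (k : ℕ) :
    G.aliveMean α Γ k (G.hittingPotential j) -
        ∑ i, G.stopProb α Γ k i * G.hittingPotential j i - G.aliveMean α Γ (k + 1) 1 ≤
      G.aliveMean α Γ (k + 1) (G.hittingPotential j) := by
  rw [aliveMean_sub_sum_stopProb, aliveMean_succ, aliveMean_succ, ← Finset.sum_sub_distrib]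
  refine Finset.sum_le_sum fun ω _ => ?_
  have hd := G.degree_pos hG (ω (Fin.last k))
  simp only [Pi.one_apply, mul_one, G.sum_transition hd]
  rw [← mul_sub_one]
  exact mul_le_mul_of_nonneg_left (G.le_sum_transition_mul_hittingPotential hG hd)
    (mul_nonneg (G.aliveProb_nonneg hα _ _ _) (Γ.continueProb_nonneg _ _))

/-- Every rule of finite mean length that leads from `μ` to `δ_j` has mean length at least the
`μ`-mean of the hitting potential. -/
theorem sum_hittingPotential_le_meanLength (hG : G.graph.Connected) {μ : V → ℝ}
    (hμ : μ ∈ stdSimplex ℝ V) {Γ : StoppingRule V} {j : V} (hfin : G.meanLength μ Γ < ⊤)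
    (hpos : ∀ i, G.positionProb μ Γ i = ENNReal.ofReal ((Pi.single j 1 : V → ℝ) i)) :
    ∑ i, μ i * G.hittingPotential j i ≤ (G.meanLength μ Γ).toReal := by
  -- On a single node the degree is `0` and the transition probability is `0 / 0 = 0`, so mass would
  -- be lost at each step.
  rcases subsingleton_or_nontrivial V with hV | hV
  · have : ∑ i, μ i * G.hittingPotential j i = 0 := Finset.sum_eq_zero fun i _ => by
      rw [Subsingleton.elim i j, hittingPotential_self, mul_zero]
    rw [this]
    exact ENNReal.toReal_nonneg
  set T := (G.meanLength μ Γ).toReal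
  have hT : ENNReal.ofReal T = G.meanLength μ Γ := ENNReal.ofReal_toReal hfin.ne
  have hdeg : ∀ k ω, Γ.continueProb k ω ≠ 0 → 0 < G.degree (ω (Fin.last k)) :=
    fun _ _ _ => G.degree_pos hG _
  have ha := G.aliveMean_one_nonneg hμ.1 Γ
  have hsum : ∀ n, ∑ k ∈ Finset.range n, G.aliveMean μ Γ (k + 1) 1 ≤ T := fun n =>
    (ENNReal.ofReal_le_ofReal_iff ENNReal.toReal_nonneg).1
      ((G.ofReal_sum_range_aliveMean_le hμ hdeg hfin n).trans hT.ge)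
  -- All stopped mass sits at `j`, where the potential is normalized to zero.
  have hvanish : ∀ k, ∑ i, G.stopProb μ Γ k i * G.hittingPotential j i = 0 := by
    refine fun k => Finset.sum_eq_zero fun i _ => ?_
    by_cases hij : i = j
    · rw [hij, hittingPotential_self, mul_zero]
    · have h := hpos i
      rw [Pi.single_eq_of_ne hij, ENNReal.ofReal_zero, positionProb, ENNReal.tsum_eq_zero] at h
      rw [le_antisymm (ENNReal.ofReal_eq_zero.1 (h k)) (G.stopProb_nonneg hμ.1 _ _ _), zero_mul]
  have hstep : ∀ n, ∑ i, μ i * G.hittingPotential j i ≤ G.aliveMean μ Γ n (G.hittingPotential j) +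
      ∑ k ∈ Finset.range n, G.aliveMean μ Γ (k + 1) 1 := by
    intro n
    induction n with
    | zero => simp [aliveMean_zero]
    | succ n ih =>
      have h := G.aliveMean_hittingPotential_le hG hμ.1 Γ j n
      rw [hvanish, sub_zero] at h
      rw [Finset.sum_range_succ]
      linarith
  obtain ⟨B, hB⟩ : ∃ B, ∀ i, |G.hittingPotential j i| ≤ B :=
    ⟨_, fun i => Finset.single_le_sum (f := fun i => |G.hittingPotential j i|)
      (fun _ _ => abs_nonneg _) (Finset.mem_univ i)⟩
  -- Finite mean makes the tails `P[Γ ≥ n]` summable, so with a bounded potential the boundary term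
  -- vanishes.
  have hlim : Tendsto (fun n => G.aliveMean μ Γ n 1) atTop (𝓝 0) := by
    have h := (summable_of_sum_range_le (fun k => ha (k + 1)) hsum).tendsto_atTop_zero
    exact (tendsto_add_atTop_iff_nat 1).1 h
  have hle : ∀ n, ∑ i, μ i * G.hittingPotential j i ≤ B * G.aliveMean μ Γ n 1 + T := fun n =>
    (hstep n).trans (add_le_add ((le_abs_self _).trans (G.abs_aliveMean_le hμ.1 Γ n hB)) (hsum n))
  simpa using ge_of_tendsto' ((hlim.const_mul B).add_const T) hle

theorem stopProb_hittingRule_of_ne (μ : V → ℝ) {i j : V} (hij : i ≠ j) (k : ℕ) :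
    G.stopProb μ (hittingRule j) k i = 0 :=
  Finset.sum_eq_zero fun ω hω => by
    have : ω (Fin.last k) ≠ j := by rwa [(Finset.mem_filter.1 hω).2]
    rw [pathStopProb_eq]
    simp [hittingRule, this]

theorem sum_stopProb_hittingRule (μ : V → ℝ) (j : V) (k : ℕ) :
    ∑ i, G.stopProb μ (hittingRule j) k i = G.stopProb μ (hittingRule j) k j :=
  Finset.sum_eq_single j (fun _ _ hi => G.stopProb_hittingRule_of_ne μ hi k) (by simp)

/-- A walk that continues is not at `j`, so a second node exists. The one-node graph thus needs no
separate treatment for this rule. -/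
theorem degree_pos_of_hittingRule (hG : G.graph.Connected) (j : V) (k : ℕ)
    (ω : Fin (k + 1) → V) (h : (hittingRule j).continueProb k ω ≠ 0) :
    ω (Fin.last k) ≠ j ∧ 0 < G.degree (ω (Fin.last k)) := by
  have hne : ω (Fin.last k) ≠ j := fun hj => h (by simp [hittingRule, hj])
  have : Nontrivial V := ⟨⟨_, _, hne⟩⟩
  exact ⟨hne, G.degree_pos hG _⟩

/-- The walk moves on only from nodes other than `j`, where the submartingale inequality is an
equality. -/
theorem aliveMean_hittingRule (hG : G.graph.Connected) (μ : V → ℝ) (j : V) (k : ℕ) :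
    G.aliveMean μ (hittingRule j) (k + 1) (G.hittingPotential j) =
      G.aliveMean μ (hittingRule j) k (G.hittingPotential j) -
        G.aliveMean μ (hittingRule j) (k + 1) 1 := by
  have hvanish : ∑ i, G.stopProb μ (hittingRule j) k i * G.hittingPotential j i = 0 :=
    Finset.sum_eq_zero fun i _ => by
      by_cases hij : i = j
      · rw [hij, hittingPotential_self, mul_zero]
      · rw [G.stopProb_hittingRule_of_ne μ hij, zero_mul]
  have h := G.aliveMean_sub_sum_stopProb μ (hittingRule j) k (G.hittingPotential j)
  rw [hvanish, sub_zero] at h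
  rw [h, aliveMean_succ, aliveMean_succ, ← Finset.sum_sub_distrib]
  refine Finset.sum_congr rfl fun ω _ => ?_
  by_cases hω : (hittingRule j).continueProb k ω = 0
  · simp [hω]
  · obtain ⟨hne, hd⟩ := G.degree_pos_of_hittingRule hG j k ω hω
    simp only [Pi.one_apply, mul_one, G.sum_transition hd]
    rw [G.sum_transition_mul_hittingPotential hG hd hne, mul_sub_one]

theorem sum_range_aliveMean_hittingRule (hG : G.graph.Connected) (μ : V → ℝ) (j : V) (n : ℕ) :
    ∑ k ∈ Finset.range n, G.aliveMean μ (hittingRule j) (k + 1) 1 =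
      ∑ i, μ i * G.hittingPotential j i -
        G.aliveMean μ (hittingRule j) n (G.hittingPotential j) := by
  induction n with
  | zero => simp [aliveMean_zero]
  | succ n ih => rw [Finset.sum_range_succ, ih, G.aliveMean_hittingRule hG]; ring

/-- Finiteness of the hitting time is not assumed: the potential is bounded and the alive mass is at
most `1`, so the martingale identity bounds the partial sums of `P[T_j ≥ k + 1]` and forces the
tails to zero. -/
theorem tendsto_aliveMean_hittingRule (hG : G.graph.Connected) {μ : V → ℝ}
    (hμ : μ ∈ stdSimplex ℝ V) (j : V) :
    Tendsto (fun n => G.aliveMean μ (hittingRule j) n 1) atTop (𝓝 0) ∧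
    Tendsto (fun n => G.aliveMean μ (hittingRule j) n (G.hittingPotential j)) atTop (𝓝 0) := by
  obtain ⟨B, hB⟩ : ∃ B, ∀ i, |G.hittingPotential j i| ≤ B :=
    ⟨_, fun i => Finset.single_le_sum (f := fun i => |G.hittingPotential j i|)
      (fun _ _ => abs_nonneg _) (Finset.mem_univ i)⟩
  have ha := G.aliveMean_one_nonneg hμ.1 (hittingRule j)
  have habs := fun n => G.abs_aliveMean_le hμ.1 (hittingRule j) n hB
  have hB0 : 0 ≤ B := (abs_nonneg _).trans (hB j)
  have hs := G.sum_range_stopProb hμ (hittingRule j)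
    fun k ω h => (G.degree_pos_of_hittingRule hG j k ω h).2
  have ha1 : ∀ n, G.aliveMean μ (hittingRule j) n 1 ≤ 1 := fun n => by
    have : 0 ≤ ∑ k ∈ Finset.range n, ∑ i, G.stopProb μ (hittingRule j) k i :=
      Finset.sum_nonneg fun k _ => G.sum_stopProb_nonneg hμ.1 _ k
    linarith [hs n]
  have hbound : ∀ n, ∑ k ∈ Finset.range n, G.aliveMean μ (hittingRule j) (k + 1) 1 ≤
      ∑ i, μ i * G.hittingPotential j i + B := fun n => by
    rw [G.sum_range_aliveMean_hittingRule hG]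
    have h1 := (abs_le.1 (habs n)).1
    have h2 := mul_le_of_le_one_right hB0 (ha1 n)
    linarith
  have h0 : Tendsto (fun n => G.aliveMean μ (hittingRule j) n 1) atTop (𝓝 0) :=
    (tendsto_add_atTop_iff_nat 1).1
      (summable_of_sum_range_le (fun k => ha (k + 1)) hbound).tendsto_atTop_zero
  refine ⟨h0, squeeze_zero_norm habs ?_⟩
  simpa using h0.const_mul B

theorem tsum_lengthProb_hittingRule (hG : G.graph.Connected) {μ : V → ℝ}
    (hμ : μ ∈ stdSimplex ℝ V) (j : V) : ∑' k, G.lengthProb μ (hittingRule j) k = 1 := by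
  have hs := G.sum_range_stopProb hμ (hittingRule j)
    fun k ω h => (G.degree_pos_of_hittingRule hG j k ω h).2
  have hnn := G.sum_stopProb_nonneg hμ.1 (hittingRule j)
  have h : HasSum (fun k => ∑ i, G.stopProb μ (hittingRule j) k i) 1 := by
    rw [hasSum_iff_tendsto_nat_of_nonneg hnn]
    simp only [hs]
    simpa using (G.tendsto_aliveMean_hittingRule hG hμ j).1.const_sub 1
  simp only [lengthProb]
  rw [← ENNReal.ofReal_tsum_of_nonneg hnn h.summable, h.tsum_eq, ENNReal.ofReal_one]

theorem positionProb_hittingRule (hG : G.graph.Connected) {μ : V → ℝ}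
    (hμ : μ ∈ stdSimplex ℝ V) (j i : V) :
    G.positionProb μ (hittingRule j) i = ENNReal.ofReal ((Pi.single j 1 : V → ℝ) i) := by
  by_cases hij : i = j
  · subst hij
    have := G.tsum_lengthProb_hittingRule hG hμ i
    simp only [lengthProb, sum_stopProb_hittingRule] at this
    simpa [positionProb] using this
  · simp [positionProb, G.stopProb_hittingRule_of_ne μ hij, hij]

/-- The nonnegativity ensures that `ENNReal.ofReal` does not truncate when the value is read back as
a real number. -/
theorem meanLength_hittingRule_le (hG : G.graph.Connected) {μ : V → ℝ}
    (hμ : μ ∈ stdSimplex ℝ V) (j : V) :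
    G.meanLength μ (hittingRule j) ≤ ENNReal.ofReal (∑ i, μ i * G.hittingPotential j i) ∧
      0 ≤ ∑ i, μ i * G.hittingPotential j i := by
  have hnn : ∀ k : ℕ, 0 ≤ (k : ℝ) * ∑ i, G.stopProb μ (hittingRule j) k i := fun k =>
    mul_nonneg k.cast_nonneg (G.sum_stopProb_nonneg hμ.1 _ k)
  have hlim : Tendsto (fun n => ∑ i, μ i * G.hittingPotential j i -
      G.aliveMean μ (hittingRule j) n (G.hittingPotential j)) atTop
      (𝓝 (∑ i, μ i * G.hittingPotential j i)) := by
    simpa using (G.tendsto_aliveMean_hittingRule hG hμ j).2.const_sub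
      (∑ i, μ i * G.hittingPotential j i)
  have hle : ∀ n, ∑ k ∈ Finset.range n, (k : ℝ) * ∑ i, G.stopProb μ (hittingRule j) k i ≤
      ∑ i, μ i * G.hittingPotential j i -
        G.aliveMean μ (hittingRule j) n (G.hittingPotential j) := fun n => by
    rw [← G.sum_range_aliveMean_hittingRule hG, G.sum_range_aliveMean μ (hittingRule j)
      (fun k ω h => (G.degree_pos_of_hittingRule hG j k ω h).2) n]
    exact le_add_of_nonneg_right
      (mul_nonneg n.cast_nonneg (G.aliveMean_one_nonneg hμ.1 _ n))
  -- The partial sums increase, so the one at `n` is bounded by the limit of the right side of `hle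
  -- m` as `m` grows.
  have hbound : ∀ n, ∑ k ∈ Finset.range n, (k : ℝ) * ∑ i, G.stopProb μ (hittingRule j) k i ≤
      ∑ i, μ i * G.hittingPotential j i := fun n =>
    ge_of_tendsto hlim <| (eventually_ge_atTop n).mono fun m hm =>
      (Finset.sum_le_sum_of_subset_of_nonneg (Finset.range_mono hm)
        fun k _ _ => hnn k).trans (hle m)
  refine ⟨?_, by simpa using hbound 0⟩
  rw [meanLength, G.tsum_lengthProb_hittingRule hG hμ, tsub_self, mul_zero, add_zero,
    ENNReal.tsum_eq_iSup_nat]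
  refine iSup_le fun n => (le_of_eq ?_).trans (ENNReal.ofReal_le_ofReal (hbound n))
  rw [ENNReal.ofReal_sum_of_nonneg fun k _ => hnn k]
  refine Finset.sum_congr rfl fun k _ => ?_
  rw [ENNReal.ofReal_mul k.cast_nonneg, ENNReal.ofReal_natCast, lengthProb]

theorem accessTime_eq_meanLength_hittingRule (hG : G.graph.Connected) {μ : V → ℝ}
    (hμ : μ ∈ stdSimplex ℝ V) (j : V) :
    G.accessTime μ (Pi.single j 1) = G.meanLength μ (hittingRule j) ∧
      G.accessTime μ (Pi.single j 1) = ENNReal.ofReal (∑ i, μ i * G.hittingPotential j i) := by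
  have hle := (G.meanLength_hittingRule_le hG hμ j).1
  have hfin := hle.trans_lt ENNReal.ofReal_lt_top
  have h1 : G.accessTime μ (Pi.single j 1) ≤ G.meanLength μ (hittingRule j) :=
    sInf_le ⟨_, rfl, hfin, G.positionProb_hittingRule hG hμ j⟩
  have h2 : ENNReal.ofReal (∑ i, μ i * G.hittingPotential j i) ≤
      G.accessTime μ (Pi.single j 1) := by
    refine le_sInf ?_
    rintro _ ⟨Γ, rfl, hΓ, hpos⟩
    exact ENNReal.ofReal_le_of_le_toReal (G.sum_hittingPotential_le_meanLength hG hμ hΓ hpos)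
  exact ⟨le_antisymm h1 (hle.trans h2), le_antisymm (h1.trans hle) h2⟩

theorem accessVec_eq (hG : G.graph.Connected) {μ : V → ℝ} (hμ : μ ∈ stdSimplex ℝ V) (j : V) :
    G.accessVec μ j = ∑ i, μ i * G.hittingPotential j i := by
  rw [accessVec, (G.accessTime_eq_meanLength_hittingRule hG hμ j).2,
    ENNReal.toReal_ofReal (G.meanLength_hittingRule_le hG hμ j).2]

theorem nodeAccess_eq (hG : G.graph.Connected) (i j : V) :
    G.nodeAccess i j = G.hittingPotential j i := by
  refine (G.accessVec_eq hG (single_mem_stdSimplex ℝ i) j).trans ?_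
  simp [Pi.single_apply]

/-- The generalized commute time formula in terms of the node access times. -/
theorem resistance_eq (hG : G.graph.Connected) {α β : V → ℝ} (hα : α ∈ stdSimplex ℝ V)
    (hβ : β ∈ stdSimplex ℝ V) :
    G.resistance α β =
      -(1 / G.vol) * ∑ i, ∑ k, (α i - β i) * (α k - β k) * G.nodeAccess i k := by
  have hx : ∑ i, (α - β) i = 0 := by simp [hα.2, hβ.2]
  -- On one node the two probability vectors coincide; otherwise the volume is positive and can be
  -- cancelled.
  rcases subsingleton_or_nontrivial V with hV | hV
  · have hz : α - β = 0 := by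
      funext i
      rw [Fintype.sum_subsingleton _ i] at hx
      exact hx
    have hz' : ∀ i, α i - β i = 0 := fun i => congrFun hz i
    simp [resistance, hz, hz']
  · have h := G.sum_sum_hittingPotential hx
    simp only [Pi.sub_apply] at h
    simp only [G.nodeAccess_eq hG, h, resistance]
    field_simp [(G.vol_pos hG).ne']

end Access
end WeightedGraph

/-! ### The generalized commute time formula -/

theorem mainTheorem2 {V : Type*} [Fintype V] [DecidableEq V]
    (G : WeightedGraph V) (hG : G.graph.Connected)
    (α β : V → ℝ) (hα : α ∈ stdSimplex ℝ V) (hβ : β ∈ stdSimplex ℝ V) :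
    -- the access times in the formulas are finite
    (∀ μ ∈ stdSimplex ℝ V, ∀ i, G.accessTime μ (Pi.single i 1) ≠ ⊤) ∧
    G.resistance α β = -(1 / G.vol) * dotProduct (α - β) (G.accessVec α - G.accessVec β) ∧
    G.resistance α β =
      -(1 / G.vol) * ∑ i, (α i - β i) * (G.accessVec α i - G.accessVec β i) ∧
    G.resistance α β =
      -(1 / G.vol) * ∑ i, ∑ k, (α i - β i) * (α k - β k) * G.nodeAccess i k ∧
    -- the case of Dirac measures: the classical commute time identity
    (∀ i j, G.accessTime (Pi.single i 1) (Pi.single j 1) = G.hittingTime i j) ∧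
    (∀ i j, G.resistance (Pi.single i 1) (Pi.single j 1) =
      (1 / G.vol) * (G.nodeAccess i j + G.nodeAccess j i)) := by
  -- Linearity of the access time in the starting distribution; the target is the second index of
  -- `nodeAccess`, hence the exchange of sums.
  have hsum : ∑ i, (α i - β i) * (G.accessVec α i - G.accessVec β i) =
      ∑ i, ∑ k, (α i - β i) * (α k - β k) * G.nodeAccess i k := by
    rw [Finset.sum_comm]
    refine Finset.sum_congr rfl fun k _ => ?_
    rw [G.accessVec_eq hG hα, G.accessVec_eq hG hβ, ← Finset.sum_sub_distrib, Finset.mul_sum]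
    refine Finset.sum_congr rfl fun i _ => ?_
    rw [G.nodeAccess_eq hG]
    ring
  have hres := G.resistance_eq hG hα hβ
  refine ⟨fun μ hμ i => ?_, ?_, ?_, hres, fun i j => ?_, fun i j => ?_⟩
  · rw [(G.accessTime_eq_meanLength_hittingRule hG hμ i).2]
    exact ENNReal.ofReal_ne_top
  · rw [hres, ← hsum]; rfl
  · rw [hres, ← hsum]
  · exact (G.accessTime_eq_meanLength_hittingRule hG (single_mem_stdSimplex ℝ i) j).1
  · rw [G.resistance_eq hG (single_mem_stdSimplex ℝ i) (single_mem_stdSimplex ℝ j)]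
    -- The double sum is `H(i,i) - H(i,j) - H(j,i) + H(j,j)`, whose diagonal terms vanish.
    have hself : ∀ k, G.nodeAccess k k = 0 := fun k => by
      rw [G.nodeAccess_eq hG, G.hittingPotential_self]
    simp only [sub_mul, mul_sub, Finset.sum_sub_distrib, Pi.single_apply, ite_mul, one_mul,
      zero_mul, mul_ite, mul_one, mul_zero, Finset.sum_ite_eq', Finset.mem_univ, if_true,
      hself]
    simp
    ring
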